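/- Consider oriented long knot diagrams in the plane: generic diagrams of a single strand, with no closed components, that enters at the bottom and leaves at the top, pointing up at both ends. Such a diagram is \emph{upright} if at every crossing both strands point up. It may carry finitely many \emph{null vertices}, that is, marked points on the strand at which the strand points up. The rotation number of a piece of strand that points up at both ends is the number of its local minima at which it heads right minus the number of its local maxima at which it heads right. Upright diagrams are considered up to planar isotopies that keep the crossings upright. The \emph{upright Reidemeister moves} are the following local moves, applied in either direction: (R1l, R1r) adding or removing a curl with a positive upright crossing, lying to the left (its loop having rotation number $+1$) or to the right (its loop having rotation number $-1$) of the strand; (R2c$^+$, R2c$^-$) adding or removing two upright crossings of opposite signs between two antiparallel strands, one of which passes over the other at both crossings; the over strand meets first the negative crossing in R2c$^+$ and first the positive one in R2c$^-$. The edge of the resulting bigon on the over strand has rotation number $0$, and the one on the under strand has rotation number $+1$ in R2c$^+$ and $-1$ in R2c$^-$; (R3b) the braid-like third Reidemeister move on three strands pointing up with three positive crossings; (NV) adding or removing a null vertex; (Sw) the swirl move: a positive crossing is rotated by a full turn, so that the rotation numbers of both of its incoming edges increase by $1$ and those of both of its outgoing edges decrease by $1$. Proposition. The upright Reidemeister moves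 are sufficient: if two upright knot diagrams, possibly with null vertices, represent the same oriented knot, meaning that the oriented long knot diagrams obtained from them by forgetting the null vertices and the uprightness are related by planar isotopies and oriented Reidemeister moves (R1, R2, R3 with all orientations and all signs) of oriented long knot diagrams, then they are connected by a finite sequence of upright Reidemeister moves. -/

import Mathlib

/-!
Long knot diagrams, sliced into horizontal layers.

A generic planar diagram is a vertical stack of layers. Each layer carries vertical strands together
with one elementary piece: a minimum (cup), a maximum (cap), a crossing, or a null vertex.
Stacks are read from the bottom of the page to the top.
-/

namespace UprightKnots

/-- The direction of travel of an oriented strand where it meets a horizontal line. -/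
inductive Dir where
  | up : Dir
  | down : Dir

/-- The opposite direction. -/
def Dir.flip : Dir → Dir
  | .up => .down
  | .down => .up

/-- Elementary pieces of an oriented planar diagram. -/
inductive Elem where
  /-- A local minimum; `d` is the direction of its left leg, the right leg has the opposite one. -/
  | cup (d : Dir) : Elem
  /-- A local maximum; `d` is the direction of its left leg, the right leg has the opposite one. -/
  | cap (d : Dir) : Elem
  /-- A crossing. The strand of direction `a` joins the bottom left to the top right, the strand of
  direction `b` joins the bottom right to the top left. The first one is the over strand if
  `s = true`, and the second one is the over strand if `s = false`. When both strands point up,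
  the crossing is positive for `s = true` and negative for `s = false`. -/
  | cross (a b : Dir) (s : Bool) : Elem
  /-- A null vertex: a marked point on a strand, at which the strand points up. -/
  | null : Elem

/-- The directions of the strands at the bottom of an elementary piece, from left to right. -/
def Elem.src : Elem → List Dir
  | .cup _ => []
  | .cap d => [d, d.flip]
  | .cross a b _ => [a, b]
  | .null => [.up]

/-- The directions of the strands at the top of an elementary piece, from left to right. -/
def Elem.tgt : Elem → List Dir
  | .cup d => [d, d.flip]
  | .cap _ => []
  | .cross a b _ => [b, a]
  | .null => [.up]

/-- A horizontal layer: one elementary piece, with vertical strands to its left and right. -/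
structure Layer where
  left : List Dir
  elem : Elem
  right : List Dir

/-- The strands at the bottom of a layer. -/
def Layer.src (L : Layer) : List Dir := L.left ++ L.elem.src ++ L.right

/-- The strands at the top of a layer. -/
def Layer.tgt (L : Layer) : List Dir := L.left ++ L.elem.tgt ++ L.right

/-- Put further vertical strands to the left and to the right of a layer. -/
def Layer.pad (l r : List Dir) (L : Layer) : Layer := ⟨l ++ L.left, L.elem, L.right ++ r⟩

/-- `IsTangle x w y`: the stack `w` is a diagram with strands `x` at the bottom and `y` at the top,
that is, consecutive layers match. -/
def IsTangle : List Dir → List Layer → List Dir → Prop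
  | x, [], y => x = y
  | x, L :: w, y => x = L.src ∧ IsTangle L.tgt w y

/-- The piece is not a null vertex. -/
def Elem.IsProper : Elem → Prop
  | .null => False
  | _ => True

/-- The piece is allowed in an upright diagram: if it is a crossing, then both strands point up. -/
def Elem.IsUpright : Elem → Prop
  | .cross .up .up _ => True
  | .cross _ _ _ => False
  | _ => True

/-- An oriented long diagram: it enters at the bottom and leaves at the top along a single strand
pointing up. Its crossings may be rotated arbitrarily. Closed components are not excluded here;
none of the steps below changes the number of components, so a sequence of steps that starts at a knot
diagram runs through knot diagrams only. -/
structure OrientedDiagram where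
  layers : List Layer
  isTangle : IsTangle [.up] layers [.up]
  proper : ∀ L ∈ layers, L.elem.IsProper

/-- An upright long diagram, possibly with null vertices: at every crossing both strands
point up. -/
structure UprightDiagram where
  layers : List Layer
  isTangle : IsTangle [.up] layers [.up]
  upright : ∀ L ∈ layers, L.elem.IsUpright

/-- Two points of a diagram are neighbours if they are joined by a piece of strand within one layer.
The point `(t, p)` is the strand number `p` (counted from the left, starting at `0`)
at the bottom of the layer number `t` (counted from the bottom, starting at `0`). -/
inductive Neighbour (w : List Layer) : ℕ × ℕ → ℕ × ℕ → Prop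
  | left (t : ℕ) (L : Layer) (h : w[t]? = some L) (p : ℕ) (hp : p < L.left.length) :
      Neighbour w (t, p) (t + 1, p)
  | right (t : ℕ) (L : Layer) (h : w[t]? = some L) (p : ℕ) (hp : p < L.right.length) :
      Neighbour w (t, L.left.length + L.elem.src.length + p)
        (t + 1, L.left.length + L.elem.tgt.length + p)
  | cup (t : ℕ) (l r : List Dir) (d : Dir) (h : w[t]? = some ⟨l, .cup d, r⟩) :
      Neighbour w (t + 1, l.length) (t + 1, l.length + 1)
  | cap (t : ℕ) (l r : List Dir) (d : Dir) (h : w[t]? = some ⟨l, .cap d, r⟩) :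
      Neighbour w (t, l.length) (t, l.length + 1)
  | crossRight (t : ℕ) (l r : List Dir) (a b : Dir) (s : Bool)
      (h : w[t]? = some ⟨l, .cross a b s, r⟩) :
      Neighbour w (t, l.length) (t + 1, l.length + 1)
  | crossLeft (t : ℕ) (l r : List Dir) (a b : Dir) (s : Bool)
      (h : w[t]? = some ⟨l, .cross a b s, r⟩) :
      Neighbour w (t, l.length + 1) (t + 1, l.length)
  | null (t : ℕ) (l r : List Dir) (h : w[t]? = some ⟨l, .null, r⟩) :
      Neighbour w (t, l.length) (t + 1, l.length)

/-- The diagram is a knot diagram: it has a single strand, so that every point of it is reached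
by travelling along the strand that enters at the bottom. -/
def UprightDiagram.IsKnot (D : UprightDiagram) : Prop :=
  ∀ (t : ℕ) (L : Layer) (p : ℕ), D.layers[t]? = some L → p < L.src.length →
    Relation.EqvGen (Neighbour D.layers) (0, 0) (t, p)

/-- Test for null vertices. -/
def Elem.isNull : Elem → Bool
  | .null => true
  | _ => false

/-- Delete all null vertices. -/
def eraseNull (w : List Layer) : List Layer := w.filter (fun L => !L.elem.isNull)

theorem isTangle_eraseNull : ∀ (w : List Layer) (x y : List Dir),
    IsTangle x w y → IsTangle x (eraseNull w) y
  | [], _, _, h => h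
  | ⟨l, .cup d, r⟩ :: w, _, _, h => ⟨h.1, isTangle_eraseNull w _ _ h.2⟩
  | ⟨l, .cap d, r⟩ :: w, _, _, h => ⟨h.1, isTangle_eraseNull w _ _ h.2⟩
  | ⟨l, .cross a b s, r⟩ :: w, _, _, h => ⟨h.1, isTangle_eraseNull w _ _ h.2⟩
  | ⟨l, .null, r⟩ :: w, x, y, h => by
      have h2 := isTangle_eraseNull w _ _ h.2
      have h1 := h.1
      change x = Layer.tgt ⟨l, .null, r⟩ at h1
      rw [h1]
      exact h2

/-- The oriented diagram underlying an upright diagram: null vertices are forgotten. -/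
def UprightDiagram.toOriented (D : UprightDiagram) : OrientedDiagram where
  layers := eraseNull D.layers
  isTangle := isTangle_eraseNull _ _ _ D.isTangle
  proper := by
    intro L hL
    have h := (List.mem_filter.mp hL).2
    rcases L with ⟨l, e, r⟩
    cases e
    · exact trivial
    · exact trivial
    · exact trivial
    · exact absurd h Bool.false_ne_true

/-- Apply a local replacement `R` somewhere in a stack: a part `u` of it, with arbitrary vertical
strands on both sides and arbitrary layers below and above, is replaced by `v`. -/
def LocalStep (R : List Layer → List Layer → Prop) (w w' : List Layer) : Prop :=
  ∃ (A B : List Layer) (l r : List Dir) (u v : List Layer), R u v ∧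
    w = A ++ u.map (Layer.pad l r) ++ B ∧ w' = A ++ v.map (Layer.pad l r) ++ B

/-- Planar isotopies that do not rotate any crossing. -/
inductive Isotopy : List Layer → List Layer → Prop
  /-- Two pieces at different places change their order of height. -/
  | exchange (e f : Elem) (m : List Dir) :
      Isotopy [⟨[], e, m ++ f.src⟩, ⟨e.tgt ++ m, f, []⟩]
        [⟨e.src ++ m, f, []⟩, ⟨[], e, m ++ f.tgt⟩]
  /-- Straightening of a zigzag. -/
  | zigzagRight (d : Dir) :
      Isotopy [⟨[d], .cup d.flip, []⟩, ⟨[], .cap d, [d]⟩] []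
  /-- Straightening of the other zigzag. -/
  | zigzagLeft (d : Dir) :
      Isotopy [⟨[], .cup d, [d]⟩, ⟨[d], .cap d.flip, []⟩] []

/-- Planar isotopies that rotate a crossing: a strand that crosses one leg of a maximum or of a
minimum is moved to the other leg. -/
inductive Rotation : List Layer → List Layer → Prop
  | cap (a b : Dir) (s : Bool) :
      Rotation [⟨[], .cross a b s, [a.flip]⟩, ⟨[b], .cap a, []⟩]
        [⟨[a], .cross b a.flip (!s), []⟩, ⟨[], .cap a, [b]⟩]
  | cup (a b : Dir) (s : Bool) :
      Rotation [⟨[], .cup a, [b]⟩, ⟨[a], .cross a.flip b s, []⟩]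
        [⟨[b], .cup a, []⟩, ⟨[], .cross b a (!s), [a.flip]⟩]

/-- The oriented Reidemeister moves, with all orientations and all crossing signs. -/
inductive Reidemeister : List Layer → List Layer → Prop
  /-- Removal of a curl to the right of the strand. -/
  | r1Right (d : Dir) (s : Bool) :
      Reidemeister [⟨[d], .cup d, []⟩, ⟨[], .cross d d s, [d.flip]⟩, ⟨[d], .cap d, []⟩] []
  /-- Removal of a curl to the left of the strand. -/
  | r1Left (d : Dir) (s : Bool) :
      Reidemeister
        [⟨[], .cup d.flip, [d]⟩, ⟨[d.flip], .cross d d s, []⟩, ⟨[], .cap d.flip, [d]⟩] []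
  /-- Separation of two strands, one of which passes over the other twice. -/
  | r2 (a b : Dir) (s : Bool) :
      Reidemeister [⟨[], .cross a b s, []⟩, ⟨[], .cross b a (!s), []⟩] []
  /-- The triangle move. Of the strands `a`, `b`, `c`, the strand `a` passes over `b` iff `s₁`,
  `a` passes over `c` iff `s₂`, and `b` passes over `c` iff `s₃`; the hypothesis says that the three
  strands can be ordered by height. -/
  | r3 (a b c : Dir) (s₁ s₂ s₃ : Bool) (h : s₁ = s₃ → s₂ = s₁) :
      Reidemeister
        [⟨[], .cross a b s₁, [c]⟩, ⟨[b], .cross a c s₂, []⟩, ⟨[], .cross b c s₃, [a]⟩]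
        [⟨[a], .cross b c s₃, []⟩, ⟨[], .cross a c s₂, [b]⟩, ⟨[c], .cross a b s₁, []⟩]

open Dir in
/-- The upright Reidemeister moves. Below, the rotation number of a piece of strand that points up
at both ends counts its minima heading right with sign `+1` and its maxima heading
right with sign `-1`. -/
inductive UprightMove : List Layer → List Layer → Prop
  /-- R1l: a positive curl to the left; the loop has rotation number `+1`. -/
  | r1l : UprightMove
      [⟨[], .cup down, [up]⟩, ⟨[down], .cross up up true, []⟩, ⟨[], .cap down, [up]⟩] []
  /-- R1r: a positive curl to the right; the loop has rotation number `-1`. -/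
  | r1r : UprightMove
      [⟨[up], .cup up, []⟩, ⟨[], .cross up up true, [down]⟩, ⟨[up], .cap up, []⟩] []
  /-- R2c⁺: antiparallel strands, the left one (pointing up) passes over a negative and then a
  positive crossing. Of the two edges of the bigon, the over one has rotation number `0` and the
  under one has rotation number `+1`. -/
  | r2cPos : UprightMove
      [⟨[], .cup down, [up, down]⟩, ⟨[down], .cross up up false, [down]⟩,
        ⟨[down, up], .cap up, []⟩, ⟨[down, up], .cup up, []⟩,
        ⟨[down], .cross up up true, [down]⟩, ⟨[], .cap down, [up, down]⟩] []
  /-- R2c⁻: antiparallel strands, the right one (pointing up) passes over a positive and then a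
  negative crossing. Of the two edges of the bigon, the over one has rotation number `0` and the
  under one has rotation number `-1`. -/
  | r2cNeg : UprightMove
      [⟨[down, up], .cup up, []⟩, ⟨[down], .cross up up true, [down]⟩,
        ⟨[], .cap down, [up, down]⟩, ⟨[], .cup down, [up, down]⟩,
        ⟨[down], .cross up up false, [down]⟩, ⟨[down, up], .cap up, []⟩] []
  /-- R3b: the braid-like triangle move with three positive crossings. -/
  | r3b : UprightMove
      [⟨[up], .cross up up true, []⟩, ⟨[], .cross up up true, [up]⟩, ⟨[up], .cross up up true, []⟩]
      [⟨[], .cross up up true, [up]⟩, ⟨[up], .cross up up true, []⟩, ⟨[], .cross up up true, [up]⟩]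
  /-- NV: removal of a null vertex. -/
  | nv : UprightMove [⟨[], .null, []⟩] []
  /-- Sw: a positive crossing is rotated by a full turn. After the turn, both incoming edges have
  rotation number `+1` and both outgoing edges have rotation number `-1`. -/
  | sw : UprightMove
      [⟨[], .cross up up true, []⟩]
      [⟨[], .cup up, [up, up]⟩,
        ⟨[up], .cup up, [down, up, up]⟩,
        ⟨[up, up], .cup down, [down, down, up, up]⟩,
        ⟨[up, up, down], .cup down, [up, down, down, up, up]⟩,
        ⟨[up, up, down, down], .cross up up true, [down, down, up, up]⟩,
        ⟨[up, up, down, down, up], .cap up, [down, up, up]⟩,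
        ⟨[up, up, down, down], .cap up, [up, up]⟩,
        ⟨[up, up, down], .cap down, [up]⟩,
        ⟨[up, up], .cap down, []⟩]

/-- One step between oriented diagrams: a planar isotopy or an oriented Reidemeister move. -/
def OrientedStep (D D' : OrientedDiagram) : Prop :=
  LocalStep (fun u v => Isotopy u v ∨ Rotation u v ∨ Reidemeister u v) D.layers D'.layers

/-- One step between upright diagrams: a planar isotopy that keeps the crossings
upright, or an upright Reidemeister move. -/
def UprightStep (D D' : UprightDiagram) : Prop :=
  LocalStep (fun u v => Isotopy u v ∨ UprightMove u v) D.layers D'.layers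

/-- Two upright diagrams represent the same oriented knot: their underlying oriented diagrams are
related by planar isotopies and oriented Reidemeister moves, in either direction. -/
def RepresentSameKnot (D D' : UprightDiagram) : Prop :=
  Relation.EqvGen OrientedStep D.toOriented D'.toOriented

/-- Two upright diagrams are connected by a finite sequence of upright Reidemeister moves, in either
direction. -/
def UprightEquivalent (D D' : UprightDiagram) : Prop :=
  Relation.EqvGen UprightStep D D'

end UprightKnots

namespace UprightKnots
open Dir

/-! Turn every crossing of an oriented diagram, by a turn that depends only on the directions of its
strands, until both strands point up (`uprightForm`). The result is upright, and upright diagrams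
are left unchanged. Since null vertices are removed by NV, it suffices that every oriented step
becomes a chain of upright moves after this turning.

Isotopies that rotate no crossing stay upright isotopies. When a strand slides from one leg of an
extremum to the other, the prescribed turns of the crossing before and after either agree up to
upright isotopy or differ by a full turn. For a positive crossing the full turn is Sw; for a
negative one it follows from Sw because R2c makes suitably turned crossings of opposite signs
inverse to each other (`uprightEqu_swirl_turnLeft`, `uprightEqu_swirl`). So every equivalence in
which crossings may rotate freely (`FlexEqu`) becomes an upright equivalence (`Equ.uprightForm`).

It remains to derive all oriented Reidemeister moves in `FlexEqu`, where the amount of turning no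
longer matters. R2c and half turns give every antiparallel R2 (`hasR2_flip`); with R1l and R1r this
gives all curls (`hasR1Right`, `hasR1Left`). R3b and antiparallel R2 give R3 with mixed signs, and
pulling a curl across a strand then yields the parallel R2 (`hasR2`). Once every R2 is available,
permuting strands and sixth turns produce every R3 (`hasR3`).

The explicit planar isotopies are verified by computation: both sides have the same `normalForm`. -/

instance Dir.decidableEq : DecidableEq Dir
  | .up, .up | .down, .down => isTrue rfl
  | .up, .down | .down, .up => isFalse nofun

instance Elem.decidableEq : DecidableEq Elem
  | .cup d, .cup d' => decidable_of_iff (d = d') (by simp)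
  | .cap d, .cap d' => decidable_of_iff (d = d') (by simp)
  | .cross a b s, .cross a' b' s' => decidable_of_iff (a = a' ∧ b = b' ∧ s = s') (by simp)
  | .null, .null => isTrue rfl
  | .cup _, .cap _ | .cup _, .cross .. | .cup _, .null => isFalse nofun
  | .cap _, .cup _ | .cap _, .cross .. | .cap _, .null => isFalse nofun
  | .cross .., .cup _ | .cross .., .cap _ | .cross .., .null => isFalse nofun
  | .null, .cup _ | .null, .cap _ | .null, .cross .. => isFalse nofun

instance Layer.decidableEq : DecidableEq Layer
  | ⟨l, e, r⟩, ⟨l', e', r'⟩ => decidable_of_iff (l = l' ∧ e = e' ∧ r = r') (by simp)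

/-- Quantifying over directions is a finite check, so a claim on concrete stacks can be settled by
computation for all directions and signs at once. -/
instance Dir.decidableForall (p : Dir → Prop) [DecidablePred p] : Decidable (∀ d, p d) :=
  decidable_of_iff (p .up ∧ p .down) ⟨fun h d => by cases d; exacts [h.1, h.2], fun h => ⟨h _, h _⟩⟩

instance IsTangle.decidable : ∀ x w y, Decidable (IsTangle x w y)
  | x, [], y => inferInstanceAs (Decidable (x = y))
  | x, L :: w, y =>
    have := IsTangle.decidable L.tgt w y
    inferInstanceAs (Decidable (x = L.src ∧ IsTangle L.tgt w y))

/-! ### Stacks with fixed boundaries and their local equivalence. -/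

theorem IsTangle.append : ∀ {u : List Layer} {x y z : List Dir} {v : List Layer},
    IsTangle x u y → IsTangle y v z → IsTangle x (u ++ v) z
  | [], _, _, _, _, h, h' => by
      have h : _ = _ := h
      subst h; exact h'
  | _ :: _, _, _, _, _, h, h' => ⟨h.1, h.2.append h'⟩

theorem IsTangle.split : ∀ {u : List Layer} {x z : List Dir} {v : List Layer},
    IsTangle x (u ++ v) z → ∃ y, IsTangle x u y ∧ IsTangle y v z
  | [], x, _, _, h => ⟨x, rfl, h⟩
  | _ :: _, _, _, _, h =>
      let ⟨y, h1, h2⟩ := h.2.split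
      ⟨y, ⟨h.1, h1⟩, h2⟩

theorem Layer.src_pad (l r : List Dir) (L : Layer) : (L.pad l r).src = l ++ L.src ++ r := by
  simp [Layer.src, Layer.pad]

theorem Layer.tgt_pad (l r : List Dir) (L : Layer) : (L.pad l r).tgt = l ++ L.tgt ++ r := by
  simp [Layer.tgt, Layer.pad]

theorem Layer.pad_pad (l r l' r' : List Dir) (L : Layer) :
    (L.pad l r).pad l' r' = L.pad (l' ++ l) (r ++ r') := by
  simp [Layer.pad]

@[simp] theorem Layer.pad_nil (L : Layer) : L.pad [] [] = L := by
  simp [Layer.pad]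

theorem map_pad_nil (w : List Layer) : w.map (Layer.pad [] []) = w := by
  simp [funext Layer.pad_nil]

theorem IsTangle.pad (l r : List Dir) : ∀ {w : List Layer} {x y : List Dir},
    IsTangle x w y → IsTangle (l ++ x ++ r) (w.map (Layer.pad l r)) (l ++ y ++ r)
  | [], _, _, h => congrArg (fun z => l ++ z ++ r) h
  | L :: w, _, _, h => by
      refine ⟨?_, ?_⟩
      · rw [Layer.src_pad, h.1]
      · have := h.2.pad l r
        rwa [← Layer.tgt_pad] at this

theorem LocalStep.context {R : List Layer → List Layer → Prop} {u v : List Layer}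
    (h : LocalStep R u v) (A B : List Layer) (l r : List Dir) :
    LocalStep R (A ++ u.map (Layer.pad l r) ++ B) (A ++ v.map (Layer.pad l r) ++ B) := by
  obtain ⟨A', B', l', r', u', v', hR, rfl, rfl⟩ := h
  refine ⟨A ++ A'.map (Layer.pad l r), B'.map (Layer.pad l r) ++ B, l ++ l', r' ++ r, u', v', hR,
    ?_, ?_⟩ <;>
  simp [Layer.pad_pad]

/-- A local step between diagrams with given boundaries: an isotopy that does not rotate crossings,
or a replacement from `S`. -/
def TangleStep (S : List Layer → List Layer → Prop) (x y : List Dir) (u v : List Layer) : Prop :=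
  LocalStep (fun u v => Isotopy u v ∨ S u v) u v ∧ IsTangle x u y ∧ IsTangle x v y

/-- Equivalence of diagrams with given boundaries, generated by isotopies that do not rotate
crossings and by the replacements from `S`. -/
def Equ (S : List Layer → List Layer → Prop) (x y : List Dir) : List Layer → List Layer → Prop :=
  Relation.EqvGen (TangleStep S x y)

variable {S : List Layer → List Layer → Prop} {x y p q : List Dir} {u v w w' : List Layer}

theorem Equ.refl (u : List Layer) : Equ S x y u u := Relation.EqvGen.refl u

theorem Equ.symm (h : Equ S x y u v) : Equ S x y v u := Relation.EqvGen.symm _ _ h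

theorem Equ.trans (h : Equ S x y u v) (h' : Equ S x y v w) : Equ S x y u w :=
  Relation.EqvGen.trans _ _ _ h h'

instance : Trans (Equ S x y) (Equ S x y) (Equ S x y) := ⟨Equ.trans⟩

theorem Equ.of_rule (h : S u v) (hu : IsTangle x u y) (hv : IsTangle x v y) : Equ S x y u v :=
  .rel _ _ ⟨⟨[], [], [], [], u, v, .inr h, by simp [map_pad_nil], by simp [map_pad_nil]⟩, hu, hv⟩

theorem Equ.context (h : Equ S p q u v) {A B : List Layer} {l r : List Dir}
    (hA : IsTangle x A (l ++ p ++ r)) (hB : IsTangle (l ++ q ++ r) B y) :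
    Equ S x y (A ++ u.map (Layer.pad l r) ++ B) (A ++ v.map (Layer.pad l r) ++ B) := by
  induction h with
  | rel u v h =>
    exact .rel _ _ ⟨h.1.context A B l r, (hA.append (h.2.1.pad l r)).append hB,
      (hA.append (h.2.2.pad l r)).append hB⟩
  | refl u => exact .refl _
  | symm u v _ ih => exact ih.symm
  | trans u v w _ _ ih₁ ih₂ => exact ih₁.trans ih₂

theorem Equ.append_left (h : Equ S p q u v) {A : List Layer} (hA : IsTangle x A p) :
    Equ S x q (A ++ u) (A ++ v) := by
  have := h.context (A := A) (B := []) (l := []) (r := []) (x := x) (y := q)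
    (by simpa using hA) (by simp [IsTangle])
  simpa [map_pad_nil] using this

theorem Equ.append_right (h : Equ S p q u v) {B : List Layer} (hB : IsTangle q B y) :
    Equ S p y (u ++ B) (v ++ B) := by
  have := h.context (A := []) (B := B) (l := []) (r := []) (x := p) (y := y)
    (by simp [IsTangle]) (by simpa using hB)
  simpa [map_pad_nil] using this

/-- Replace the part `u` of `w` that starts at height `i`, with strands `l` to its left and `r` to
its right, by the equivalent diagram `v`. -/
theorem Equ.rewrite (h : Equ S p q u v) (i : ℕ) (l r : List Dir)
    (hc : w = w.take i ++ u.map (Layer.pad l r) ++ w.drop (i + u.length) ∧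
      w' = w.take i ++ v.map (Layer.pad l r) ++ w.drop (i + u.length) ∧
      IsTangle x (w.take i) (l ++ p ++ r) ∧ IsTangle (l ++ q ++ r) (w.drop (i + u.length)) y) :
    Equ S x y w w' := by
  obtain ⟨h1, rfl, h3, h4⟩ := hc
  have := h.context h3 h4
  rwa [← h1] at this

/-- `Isotopy.exchange` moves one layer past one layer; induction on `v` moves it past a whole stack.
-/
theorem Equ.exchange_layer (L : Layer) (m : List Dir) : ∀ {v : List Layer} {z t : List Dir},
    IsTangle z v t → Equ S (L.src ++ m ++ z) (L.tgt ++ m ++ t)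
      (L.pad [] (m ++ z) :: v.map (Layer.pad (L.tgt ++ m) []))
      (v.map (Layer.pad (L.src ++ m) []) ++ [L.pad [] (m ++ t)])
  | [], z, t, hv => by
    have hv : z = t := hv
    subst hv
    exact .refl _
  | M :: v, z, t, hv => by
    have ih := (Equ.exchange_layer L m hv.2).append_left
      (A := [M.pad (L.src ++ m) []]) (x := L.src ++ m ++ M.src)
      ⟨by simp [Layer.src_pad], by simp [Layer.tgt_pad, IsTangle]⟩
    obtain ⟨rfl, hv⟩ := hv
    have h0 : IsTangle (L.tgt ++ m ++ M.tgt) (v.map (Layer.pad (L.tgt ++ m) []))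
        (L.tgt ++ m ++ t) := by simpa using hv.pad (L.tgt ++ m) []
    refine Equ.trans ?_ ih
    refine Equ.append_right (u := [L.pad [] (m ++ M.src), M.pad (L.tgt ++ m) []])
      (v := [M.pad (L.src ++ m) [], L.pad [] (m ++ M.tgt)]) ?_ h0
    obtain ⟨l, e, r⟩ := L
    obtain ⟨l', f, r'⟩ := M
    refine .rel _ _ ⟨⟨[], [], l, r', _, _, .inl (.exchange e f (r ++ m ++ l')), ?_, ?_⟩, ?_, ?_⟩ <;>
      simp [Layer.pad, IsTangle, Layer.src, Layer.tgt]

/-- Interchange of the heights of two diagrams that lie side by side. -/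
theorem Equ.exchange (m : List Dir) {z t : List Dir} {v : List Layer} (hv : IsTangle z v t) :
    ∀ {u : List Layer} {x y : List Dir}, IsTangle x u y →
      Equ S (x ++ m ++ z) (y ++ m ++ t)
        (u.map (Layer.pad [] (m ++ z)) ++ v.map (Layer.pad (y ++ m) []))
        (v.map (Layer.pad (x ++ m) []) ++ u.map (Layer.pad [] (m ++ t)))
  | [], x, y, hu => by
    have hu : x = y := hu
    subst hu
    simpa using Equ.refl _
  | L :: u, x, y, hu => by
    obtain ⟨rfl, hu⟩ := hu
    have ih := (Equ.exchange m hv hu).append_left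
      (A := [L.pad [] (m ++ z)]) (x := L.src ++ m ++ z)
      ⟨by simp [Layer.src_pad], by simp [Layer.tgt_pad, IsTangle]⟩
    have hL := (Equ.exchange_layer L m hv (S := S)).append_right
      (B := u.map (Layer.pad [] (m ++ t))) (y := y ++ m ++ t) (by simpa using hu.pad [] (m ++ t))
    simpa using ih.trans (by simpa using hL)

/-! ### A computable normal form for isotopies that rotate no crossing. -/

/-- Two layers that lie side by side, `M` above and (for `right = true`) to the right of `L`, change
their order of height. -/
def exchangeLayers (right : Bool) (L M : Layer) : Option (Layer × Layer) :=
  match right with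
  | true =>
    let m := M.left.drop (L.left.length + L.elem.tgt.length)
    if M.left = L.left ++ L.elem.tgt ++ m ∧ L.right = m ++ M.elem.src ++ M.right then
      some (⟨L.left ++ L.elem.src ++ m, M.elem, M.right⟩,
        ⟨L.left, L.elem, m ++ M.elem.tgt ++ M.right⟩)
    else none
  | false =>
    let m := L.left.drop (M.left.length + M.elem.src.length)
    if L.left = M.left ++ M.elem.src ++ m ∧ M.right = m ++ L.elem.tgt ++ L.right then
      some (⟨M.left, M.elem, m ++ L.elem.src ++ L.right⟩,
        ⟨M.left ++ M.elem.tgt ++ m, L.elem, L.right⟩)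
    else none

/-- The layers `L` and, above it, `M` form a zigzag. -/
def IsZigzag (L M : Layer) : Bool :=
  match L, M with
  | ⟨l, .cup d, r⟩, ⟨l', .cap d', r'⟩ =>
    d = d'.flip ∧ (l = l' ++ [d'] ∧ r' = d' :: r ∨ l' = l ++ [d] ∧ r = d :: r')
  | _, _ => false

/-- Put a layer below a stack, and let it rise as long as it lies to the left (or to the right) of
the next layer; a zigzag that arises is straightened. -/
def insertLayer (right : Bool) (L : Layer) : List Layer → List Layer
  | [] => [L]
  | M :: w =>
    if IsZigzag L M then w else
      match exchangeLayers right L M with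
      | some (M', L') => M' :: insertLayer right L' w
      | none => L :: M :: w

/-- Sort the layers of a stack by exchanges, straightening zigzags. -/
def sortLayers (right : Bool) : List Layer → List Layer
  | [] => []
  | L :: w => insertLayer right L (sortLayers right w)

/-- A normal form for stacks up to isotopies that do not rotate crossings. -/
def normalForm (w : List Layer) : List Layer :=
  (fun w => sortLayers true (sortLayers false w))^[3] w

theorem IsTangle.pair_append {L M : Layer} (h : IsTangle x (L :: M :: w) y) :
    IsTangle x [L, M] M.tgt ∧ IsTangle M.tgt w y :=
  ⟨⟨h.1, h.2.1, rfl⟩, h.2.2⟩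

theorem exchangeLayers_equ {right : Bool} {L M L' M' : Layer}
    (h : exchangeLayers right L M = some (M', L')) (ht : IsTangle x [L, M] y) :
    IsTangle x [M', L'] y ∧ Equ S x y [L, M] [M', L'] := by
  obtain ⟨h1, h2, h3⟩ := ht
  cases right
  · simp only [exchangeLayers] at h
    split_ifs at h with hc
    simp only [Option.some.injEq, Prod.mk.injEq] at h
    obtain ⟨rfl, rfl⟩ := h
    obtain ⟨l, e, r⟩ := L
    obtain ⟨l', f, r'⟩ := M
    simp only at hc ⊢
    generalize l.drop _ = m at hc ⊢
    obtain ⟨rfl, rfl⟩ := hc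
    have hM : IsTangle x [⟨l', f, m ++ e.src ++ r⟩, ⟨l' ++ f.tgt ++ m, e, r⟩] y := by
      refine ⟨?_, ?_, ?_⟩
      · rw [h1]; simp [Layer.src]
      · simp [Layer.src, Layer.tgt]
      · rw [← (show _ = y from h3)]; simp [Layer.tgt, IsTangle]
    refine ⟨hM, Equ.symm (.rel _ _ ⟨⟨[], [], l', r, _, _, .inl (.exchange f e m), ?_, ?_⟩, hM,
      ⟨h1, h2, h3⟩⟩)⟩ <;> simp [Layer.pad]
  · simp only [exchangeLayers] at h
    split_ifs at h with hc
    simp only [Option.some.injEq, Prod.mk.injEq] at h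
    obtain ⟨rfl, rfl⟩ := h
    obtain ⟨l, e, r⟩ := L
    obtain ⟨l', f, r'⟩ := M
    simp only at hc ⊢
    generalize l'.drop _ = m at hc ⊢
    obtain ⟨rfl, rfl⟩ := hc
    have hM : IsTangle x [⟨l ++ e.src ++ m, f, r'⟩, ⟨l, e, m ++ f.tgt ++ r'⟩] y := by
      refine ⟨?_, ?_, ?_⟩
      · rw [h1]; simp [Layer.src]
      · simp [Layer.src, Layer.tgt]
      · rw [← (show _ = y from h3)]; simp [Layer.tgt, IsTangle]
    refine ⟨hM, .rel _ _ ⟨⟨[], [], l, r', _, _, .inl (.exchange e f m), ?_, ?_⟩,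
      ⟨h1, h2, h3⟩, hM⟩⟩ <;> simp [Layer.pad]

theorem equ_of_isZigzag {L M : Layer} (h : IsZigzag L M) (ht : IsTangle x [L, M] y) :
    x = y ∧ Equ S x y [L, M] [] := by
  obtain ⟨h1, h2, h3⟩ := ht
  unfold IsZigzag at h
  split at h
  · next l d r l' d' r' =>
    simp only [Bool.decide_and, decide_eq_true_eq, Bool.and_eq_true, Bool.or_eq_true,
      Bool.decide_or] at h
    obtain ⟨rfl, ⟨rfl, rfl⟩ | ⟨rfl, rfl⟩⟩ := h
    · have hxy : x = y := by
        rw [h1, ← (show _ = y from h3)]; simp [Layer.src, Layer.tgt, Elem.src, Elem.tgt]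
      exact ⟨hxy, .rel _ _ ⟨⟨[], [], l', r, _, _, .inl (.zigzagRight d'), by simp [Layer.pad],
        by simp⟩, ⟨h1, h2, h3⟩, hxy⟩⟩
    · have hxy : x = y := by
        rw [h1, ← (show _ = y from h3)]; simp [Layer.src, Layer.tgt, Elem.src, Elem.tgt]
      refine ⟨hxy, .rel _ _ ⟨⟨[], [], l, r', _, _, .inl (.zigzagLeft d'.flip), ?_,
        by simp⟩, ⟨h1, h2, h3⟩, hxy⟩⟩
      cases d' <;> simp [Layer.pad, Dir.flip]
  · simp at h

theorem insertLayer_equ (right : Bool) : ∀ (w : List Layer) (L : Layer) (x : List Dir),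
    IsTangle x (L :: w) y →
      IsTangle x (insertLayer right L w) y ∧ Equ S x y (L :: w) (insertLayer right L w)
  | [], L, x, h => ⟨h, .refl _⟩
  | M :: w, L, x, h => by
    have hp := h.pair_append
    unfold insertLayer
    split_ifs with hz
    · obtain ⟨rfl, he⟩ := equ_of_isZigzag hz hp.1 (S := S)
      exact ⟨hp.2, he.append_right hp.2⟩
    · split
      · next M' L' hs =>
        obtain ⟨ht, he⟩ := exchangeLayers_equ hs hp.1 (S := S)
        have ht2 : IsTangle M'.tgt (L' :: w) y := ⟨ht.2.1, by
          rw [show L'.tgt = M.tgt from ht.2.2]; exact hp.2⟩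
        have ih := insertLayer_equ right w L' M'.tgt ht2
        exact ⟨⟨ht.1, ih.1⟩, (he.append_right hp.2).trans
          (ih.2.append_left (A := [M']) ⟨ht.1, rfl⟩)⟩
      · exact ⟨h, .refl _⟩

theorem sortLayers_equ (right : Bool) : ∀ (w : List Layer) (x : List Dir), IsTangle x w y →
    IsTangle x (sortLayers right w) y ∧ Equ S x y w (sortLayers right w)
  | [], _, h => ⟨h, .refl _⟩
  | L :: w, x, h => by
    have ih := sortLayers_equ right w L.tgt h.2
    have hi := insertLayer_equ right (sortLayers right w) L x ⟨h.1, ih.1⟩ (S := S)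
    exact ⟨hi.1, (ih.2.append_left (A := [L]) ⟨h.1, rfl⟩).trans hi.2⟩

/-- Sorting uses only exchanges and straightenings, so it never leaves the isotopy class. This
soundness is all that is needed: it holds for any number of rounds, and no completeness of the
normal form is claimed. -/
theorem normalForm_equ (h : IsTangle x w y) : Equ S x y w (normalForm w) := by
  have key : ∀ (n : ℕ) (w : List Layer), IsTangle x w y →
      Equ S x y w ((fun w => sortLayers true (sortLayers false w))^[n] w) := by
    intro n
    induction n with
    | zero => exact fun w _ => .refl _
    | succ n ih =>
      intro w h
      have h1 := sortLayers_equ false w x h (S := S)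
      have h2 := sortLayers_equ true _ x h1.1 (S := S)
      exact (h1.2.trans h2.2).trans (ih _ h2.1)
  exact key 3 w h

/-- Diagrams with the same normal form are equivalent. -/
theorem Equ.iso (h : IsTangle x w y ∧ IsTangle x w' y ∧ normalForm w = normalForm w') :
    Equ S x y w w' := by
  have h1 := normalForm_equ h.1 (S := S)
  rw [h.2.2] at h1
  exact h1.trans (normalForm_equ h.2.1).symm

/-! ### Turning crossings freely. -/

/-- The upright moves together with the rotations of crossings. -/
inductive FlexMove : List Layer → List Layer → Prop
  | rotation {u v : List Layer} (h : Rotation u v) : FlexMove u v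
  | upright {u v : List Layer} (h : UprightMove u v) : FlexMove u v

/-- Equivalence generated by all planar isotopies and the upright moves. -/
abbrev FlexEqu : List Dir → List Dir → List Layer → List Layer → Prop := Equ FlexMove

theorem flexEqu_rotation_cap (a b : Dir) (s : Bool) :
    FlexEqu [a, b, a.flip] [b]
      [⟨[], .cross a b s, [a.flip]⟩, ⟨[b], .cap a, []⟩]
      [⟨[a], .cross b a.flip (!s), []⟩, ⟨[], .cap a, [b]⟩] :=
  .of_rule (.rotation (.cap a b s)) (by decide +kernel +revert) (by decide +kernel +revert)

theorem flexEqu_rotation_cup (a b : Dir) (s : Bool) :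
    FlexEqu [b] [a, b, a.flip]
      [⟨[], .cup a, [b]⟩, ⟨[a], .cross a.flip b s, []⟩]
      [⟨[b], .cup a, []⟩, ⟨[], .cross b a (!s), [a.flip]⟩] :=
  .of_rule (.rotation (.cup a b s)) (by decide +kernel +revert) (by decide +kernel +revert)

/-- A crossing is a quarter turn of another crossing. -/
theorem flexEqu_cross_turn_left (a b : Dir) (s : Bool) :
    FlexEqu [b, a.flip] [a.flip, b] [⟨[], .cross b a.flip (!s), []⟩]
      [⟨[], .cup a.flip, [b, a.flip]⟩, ⟨[a.flip], .cross a b s, [a.flip]⟩,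
        ⟨[a.flip, b], .cap a, []⟩] :=
  calc
    FlexEqu [b, a.flip] [a.flip, b] _
      -- A zigzag is put into the strand of direction `a.flip`; its maximum then allows a rotation.
      [⟨[], .cup a.flip, [b, a.flip]⟩, ⟨[a.flip, a], .cross b a.flip (!s), []⟩,
        ⟨[a.flip], .cap a, [b]⟩] := .iso (by decide +kernel +revert)
    FlexEqu [b, a.flip] [a.flip, b] _ _ :=
      (flexEqu_rotation_cap a b s).symm.rewrite 1 [a.flip] [] (by decide +kernel +revert)

theorem flexEqu_cross_turn_right (a b : Dir) (s : Bool) :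
    FlexEqu [b.flip, a] [a, b.flip] [⟨[], .cross b.flip a (!s), []⟩]
      [⟨[b.flip, a], .cup b, []⟩, ⟨[b.flip], .cross a b s, [b.flip]⟩,
        ⟨[], .cap b.flip, [a, b.flip]⟩] :=
  calc
    FlexEqu [b.flip, a] [a, b.flip] _
      [⟨[b.flip], .cup b, [a]⟩, ⟨[b.flip, b], .cross b.flip a (!s), []⟩,
        ⟨[], .cap b.flip, [a, b.flip]⟩] := .iso (by decide +kernel +revert)
    FlexEqu [b.flip, a] [a, b.flip] _ _ :=
      (flexEqu_rotation_cup b a (!s)).rewrite 0 [b.flip] [] (by decide +kernel +revert)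

/-- A crossing turned upside down. -/
theorem flexEqu_cross_half_turn (a b : Dir) (s : Bool) :
    FlexEqu [b.flip, a.flip] [a.flip, b.flip] [⟨[], .cross b.flip a.flip s, []⟩]
      [⟨[], .cup a.flip, [b.flip, a.flip]⟩, ⟨[a.flip], .cup b.flip, [a, b.flip, a.flip]⟩,
        ⟨[a.flip, b.flip], .cross b a s, [b.flip, a.flip]⟩,
        ⟨[a.flip, b.flip, a], .cap b, [a.flip]⟩, ⟨[a.flip, b.flip], .cap a, []⟩] :=
  calc
    FlexEqu [b.flip, a.flip] [a.flip, b.flip] _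
      [⟨[], .cup a.flip, [b.flip, a.flip]⟩, ⟨[a.flip], .cross a b.flip (!s), [a.flip]⟩,
        ⟨[a.flip, b.flip], .cap a, []⟩] :=
      (flexEqu_cross_turn_left a b.flip (!s)).rewrite 0 [] [] (by decide +kernel +revert)
    FlexEqu [b.flip, a.flip] [a.flip, b.flip] _ _ :=
      (flexEqu_cross_turn_left b a s).rewrite 1 [a.flip] [a.flip] (by decide +kernel +revert)

/-! ### All oriented Reidemeister moves, with free rotation of crossings. -/

/-- The second Reidemeister move. -/
def HasR2 (a b : Dir) (s : Bool) : Prop :=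
  FlexEqu [a, b] [a, b] [⟨[], .cross a b s, []⟩, ⟨[], .cross b a (!s), []⟩] []

/-- The third Reidemeister move. -/
def HasR3 (a b c : Dir) (s₁ s₂ s₃ : Bool) : Prop :=
  FlexEqu [a, b, c] [c, b, a]
    [⟨[], .cross a b s₁, [c]⟩, ⟨[b], .cross a c s₂, []⟩, ⟨[], .cross b c s₃, [a]⟩]
    [⟨[a], .cross b c s₃, []⟩, ⟨[], .cross a c s₂, [b]⟩, ⟨[c], .cross a b s₁, []⟩]

/-- Removal of a curl to the right. -/
def HasR1Right (d : Dir) (s : Bool) : Prop :=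
  FlexEqu [d] [d] [⟨[d], .cup d, []⟩, ⟨[], .cross d d s, [d.flip]⟩, ⟨[d], .cap d, []⟩] []

/-- Removal of a curl to the left. -/
def HasR1Left (d : Dir) (s : Bool) : Prop :=
  FlexEqu [d] [d]
    [⟨[], .cup d.flip, [d]⟩, ⟨[d.flip], .cross d d s, []⟩, ⟨[], .cap d.flip, [d]⟩] []

/-- Turning the two crossings upright by quarter turns in opposite directions produces exactly the
stack of R2c⁺. -/
theorem hasR2_up_down_true : HasR2 up down true :=
  calc
    FlexEqu [up, down] [up, down] _
      [⟨[], .cup down, [up, down]⟩, ⟨[down], .cross up up false, [down]⟩,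
        ⟨[down, up], .cap up, []⟩, ⟨[], .cross down up false, []⟩] :=
      (flexEqu_cross_turn_left up up false).rewrite 0 [] [] (by decide +kernel)
    FlexEqu [up, down] [up, down] _ _ :=
      (flexEqu_cross_turn_right up up true).rewrite 3 [] [] (by decide +kernel)
    FlexEqu [up, down] [up, down] _ _ :=
      .of_rule (.upright .r2cPos) (by decide +kernel) (by decide +kernel)

theorem hasR2_down_up_false : HasR2 down up false :=
  calc
    FlexEqu [down, up] [down, up] _
      [⟨[down, up], .cup up, []⟩, ⟨[down], .cross up up true, [down]⟩,
        ⟨[], .cap down, [up, down]⟩, ⟨[], .cross up down true, []⟩] :=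
      (flexEqu_cross_turn_right up up true).rewrite 0 [] [] (by decide +kernel)
    FlexEqu [down, up] [down, up] _ _ :=
      (flexEqu_cross_turn_left up up false).rewrite 3 [] [] (by decide +kernel)
    FlexEqu [down, up] [down, up] _ _ :=
      .of_rule (.upright .r2cNeg) (by decide +kernel) (by decide +kernel)

/-- The second Reidemeister move, turned upside down. -/
theorem HasR2.rotate {a b : Dir} {s : Bool} (h : HasR2 a b s) : HasR2 b.flip a.flip (!s) :=
  calc
    FlexEqu [b.flip, a.flip] [b.flip, a.flip] _
      [⟨[], .cup a.flip, [b.flip, a.flip]⟩,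
        ⟨[a.flip], .cup b.flip, [a, b.flip, a.flip]⟩,
        ⟨[a.flip, b.flip], .cross b a (!s), [b.flip, a.flip]⟩,
        ⟨[a.flip, b.flip, a], .cap b, [a.flip]⟩,
        ⟨[a.flip, b.flip], .cap a, []⟩, ⟨[], .cross a.flip b.flip s, []⟩] :=
      (flexEqu_cross_half_turn a b (!s)).rewrite 0 [] [] (by clear h; decide +kernel +revert)
    FlexEqu [b.flip, a.flip] [b.flip, a.flip] _
      [⟨[], .cup a.flip, [b.flip, a.flip]⟩,
        ⟨[a.flip], .cup b.flip, [a, b.flip, a.flip]⟩,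
        ⟨[a.flip, b.flip], .cross b a (!s), [b.flip, a.flip]⟩,
        ⟨[a.flip, b.flip, a], .cap b, [a.flip]⟩,
        ⟨[a.flip, b.flip], .cap a, []⟩,
        ⟨[], .cup b.flip, [a.flip, b.flip]⟩,
        ⟨[b.flip], .cup a.flip, [b, a.flip, b.flip]⟩,
        ⟨[b.flip, a.flip], .cross a b s, [a.flip, b.flip]⟩,
        ⟨[b.flip, a.flip, b], .cap a, [b.flip]⟩,
        ⟨[b.flip, a.flip], .cap b, []⟩] :=
      (flexEqu_cross_half_turn b a s).rewrite 5 [] [] (by clear h; decide +kernel +revert)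
    -- The maxima above the first crossing and the minima below the second form zigzags;
    -- straightening them makes the two crossings adjacent.
    FlexEqu [b.flip, a.flip] [b.flip, a.flip] _
      [⟨[], .cup b.flip, [b.flip, a.flip]⟩,
        ⟨[b.flip], .cup a.flip, [b, b.flip, a.flip]⟩,
        ⟨[b.flip, a.flip], .cross a b s, [b.flip, a.flip]⟩,
        ⟨[b.flip, a.flip], .cross b a (!s), [b.flip, a.flip]⟩,
        ⟨[b.flip, a.flip, a], .cap b, [a.flip]⟩,
        ⟨[b.flip, a.flip], .cap a, []⟩] := .iso (by clear h; decide +kernel +revert)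
    FlexEqu [b.flip, a.flip] [b.flip, a.flip] _
      [⟨[], .cup b.flip, [b.flip, a.flip]⟩,
        ⟨[b.flip], .cup a.flip, [b, b.flip, a.flip]⟩,
        ⟨[b.flip, a.flip, a], .cap b, [a.flip]⟩,
        ⟨[b.flip, a.flip], .cap a, []⟩] :=
      h.rewrite 2 [b.flip, a.flip] [b.flip, a.flip] (by clear h; decide +kernel +revert)
    FlexEqu [b.flip, a.flip] [b.flip, a.flip] _ [] := .iso (by clear h; decide +kernel +revert)

/-- A half turn keeps the pair of directions of two antiparallel strands but changes `s`, so the two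
R2c moves reach all four cases. -/
theorem hasR2_flip : ∀ (d : Dir) (s : Bool), HasR2 d d.flip s
  | up, true => hasR2_up_down_true
  | up, false => hasR2_up_down_true.rotate
  | down, true => hasR2_down_up_false.rotate
  | down, false => hasR2_down_up_false

/-- The third Reidemeister move, turned by a sixth of a full turn. -/
theorem HasR3.rotate {a b c : Dir} {s₁ s₂ s₃ : Bool} (h : HasR3 a b c s₁ s₂ s₃) :
    HasR3 b c a.flip s₃ (!s₁) (!s₂) :=
  calc
    FlexEqu [b, c, a.flip] [a.flip, c, b] _
      [⟨[], .cross b c s₃, [a.flip]⟩,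
        ⟨[c], .cup a.flip, [b, a.flip]⟩, ⟨[c, a.flip], .cross a b s₁, [a.flip]⟩,
        ⟨[c, a.flip, b], .cap a, []⟩,
        ⟨[], .cross c a.flip (!s₂), [b]⟩] :=
      (flexEqu_cross_turn_left a b s₁).rewrite 1 [c] [] (by clear h; decide +kernel +revert)
    FlexEqu [b, c, a.flip] [a.flip, c, b] _
      [⟨[], .cross b c s₃, [a.flip]⟩,
        ⟨[c], .cup a.flip, [b, a.flip]⟩, ⟨[c, a.flip], .cross a b s₁, [a.flip]⟩,
        ⟨[c, a.flip, b], .cap a, []⟩,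
        ⟨[], .cup a.flip, [c, a.flip, b]⟩, ⟨[a.flip], .cross a c s₂, [a.flip, b]⟩,
        ⟨[a.flip, c], .cap a, [b]⟩] :=
      (flexEqu_cross_turn_left a c s₂).rewrite 4 [] [b] (by clear h; decide +kernel +revert)
    -- The bends made at the two crossings of `a` merge into one minimum below and one maximum above
    -- the original triangle.
    FlexEqu [b, c, a.flip] [a.flip, c, b] _
      [⟨[], .cup a.flip, [b, c, a.flip]⟩,
        ⟨[a.flip, a], .cross b c s₃, [a.flip]⟩, ⟨[a.flip], .cross a c s₂, [b, a.flip]⟩,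
        ⟨[a.flip, c], .cross a b s₁, [a.flip]⟩,
        ⟨[a.flip, c, b], .cap a, []⟩] := .iso (by clear h; decide +kernel +revert)
    FlexEqu [b, c, a.flip] [a.flip, c, b] _
      [⟨[], .cup a.flip, [b, c, a.flip]⟩,
        ⟨[a.flip], .cross a b s₁, [c, a.flip]⟩, ⟨[a.flip, b], .cross a c s₂, [a.flip]⟩,
        ⟨[a.flip], .cross b c s₃, [a, a.flip]⟩,
        ⟨[a.flip, c, b], .cap a, []⟩] :=
      h.symm.rewrite 1 [a.flip] [a.flip] (by clear h; decide +kernel +revert)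
    FlexEqu [b, c, a.flip] [a.flip, c, b] _
      [⟨[b], .cup a.flip, [c, a.flip]⟩, ⟨[b, a.flip], .cross a c s₂, [a.flip]⟩,
        ⟨[b, a.flip, c], .cap a, []⟩,
        ⟨[], .cup a.flip, [b, a.flip, c]⟩, ⟨[a.flip], .cross a b s₁, [a.flip, c]⟩,
        ⟨[a.flip, b], .cap a, [c]⟩,
        ⟨[a.flip], .cross b c s₃, []⟩] := .iso (by clear h; decide +kernel +revert)
    FlexEqu [b, c, a.flip] [a.flip, c, b] _
      [⟨[b], .cup a.flip, [c, a.flip]⟩, ⟨[b, a.flip], .cross a c s₂, [a.flip]⟩,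
        ⟨[b, a.flip, c], .cap a, []⟩, ⟨[], .cross b a.flip (!s₁), [c]⟩,
        ⟨[a.flip], .cross b c s₃, []⟩] :=
      (flexEqu_cross_turn_left a b s₁).symm.rewrite 3 [] [c] (by clear h; decide +kernel +revert)
    FlexEqu [b, c, a.flip] [a.flip, c, b] _ _ :=
      (flexEqu_cross_turn_left a c s₂).symm.rewrite 0 [b] [] (by clear h; decide +kernel +revert)
    FlexEqu [b, c, a.flip] [a.flip, c, b]
      [⟨[b], .cross c a.flip (!s₂), []⟩, ⟨[], .cross b a.flip (!s₁), [c]⟩,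
        ⟨[a.flip], .cross b c s₃, []⟩] _ := Equ.refl _

theorem Dir.flip_flip (d : Dir) : d.flip.flip = d := by cases d <;> rfl

theorem HasR3.rotate_back {a b c : Dir} {s₁ s₂ s₃ : Bool} (h : HasR3 a b c s₁ s₂ s₃) :
    HasR3 c.flip a b (!s₂) (!s₃) s₁ := by
  simpa [Dir.flip_flip] using h.rotate.rotate.rotate.rotate.rotate

/-- Exchange of the first two strands of the third Reidemeister move. -/
theorem HasR3.swap_left {a b c : Dir} {s₁ s₂ s₃ : Bool} (h : HasR3 a b c s₁ s₂ s₃)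
    (hab : HasR2 a b s₁) (hba : HasR2 b a (!s₁)) : HasR3 b a c (!s₁) s₃ s₂ :=
  calc
    -- Conjugation by the crossing of `a` and `b`: a cancelling pair added on top completes the
    -- right side of `h`, and after `h` the two lowest crossings cancel.
    FlexEqu [b, a, c] [c, a, b] _
      [⟨[], .cross b a (!s₁), [c]⟩, ⟨[a], .cross b c s₃, []⟩, ⟨[], .cross a c s₂, [b]⟩,
        ⟨[c], .cross a b s₁, []⟩, ⟨[c], .cross b a (!s₁), []⟩] :=
      hab.symm.rewrite 3 [c] [] (by clear h hab hba; decide +kernel +revert)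
    FlexEqu [b, a, c] [c, a, b] _
      [⟨[], .cross b a (!s₁), [c]⟩, ⟨[], .cross a b s₁, [c]⟩, ⟨[b], .cross a c s₂, []⟩,
        ⟨[], .cross b c s₃, [a]⟩, ⟨[c], .cross b a (!s₁), []⟩] :=
      h.symm.rewrite 1 [] [] (by clear h hab hba; decide +kernel +revert)
    FlexEqu [b, a, c] [c, a, b] _ _ :=
      hba.rewrite 0 [] [c] (by clear h hab hba; decide +kernel +revert)

/-- Exchange of the last two strands of the third Reidemeister move. -/
theorem HasR3.swap_right {a b c : Dir} {s₁ s₂ s₃ : Bool} (h : HasR3 a b c s₁ s₂ s₃)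
    (hbc : HasR2 b c s₃) (hcb : HasR2 c b (!s₃)) : HasR3 a c b s₂ s₁ (!s₃) := by
  simpa [Dir.flip_flip] using (h.rotate.swap_left hbc hcb).rotate_back

/-- The first Reidemeister move turns a minimum over. -/
theorem HasR1Right.cup {d : Dir} {s : Bool} (h : HasR1Right d s) :
    FlexEqu [] [d.flip, d] [⟨[], .cup d, []⟩, ⟨[], .cross d d.flip (!s), []⟩]
      [⟨[], .cup d.flip, []⟩] :=
  calc
    FlexEqu [] [d.flip, d] _
      [⟨[], .cup d.flip, []⟩, ⟨[d.flip, d], .cup d, []⟩,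
        ⟨[d.flip, d], .cross d d.flip (!s), []⟩, ⟨[d.flip], .cap d, [d]⟩] :=
      .iso (by clear h; decide +kernel +revert)
    FlexEqu [] [d.flip, d] _
      [⟨[], .cup d.flip, []⟩, ⟨[d.flip, d], .cup d, []⟩,
        ⟨[d.flip], .cross d d s, [d.flip]⟩, ⟨[d.flip, d], .cap d, []⟩] :=
      (flexEqu_rotation_cap d d s).symm.rewrite 2 [d.flip] [] (by clear h; decide +kernel +revert)
    FlexEqu [] [d.flip, d] _ _ := h.rewrite 1 [d.flip] [] (by clear h; decide +kernel +revert)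

/-- By `HasR1Right.cup` the minimum of the curl can be turned over at the price of a crossing, which
cancels the crossing of the curl by antiparallel R2. The strand is reversed and the sign of the curl
changes. -/
theorem HasR1Right.flip {d : Dir} {s : Bool} (h : HasR1Right d s) : HasR1Right d.flip (!s) :=
  calc
    FlexEqu [d.flip] [d.flip] _
      [⟨[d.flip], .cup d.flip, []⟩, ⟨[d.flip], .cross d.flip d s, []⟩,
        ⟨[], .cap d.flip, [d.flip]⟩] :=
      (flexEqu_rotation_cap d.flip d.flip (!s)).rewrite 1 [] []
        (by clear h; decide +kernel +revert)
    FlexEqu [d.flip] [d.flip] _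
      [⟨[d.flip], .cup d, []⟩, ⟨[d.flip], .cross d d.flip (!s), []⟩,
        ⟨[d.flip], .cross d.flip d s, []⟩, ⟨[], .cap d.flip, [d.flip]⟩] :=
      h.cup.symm.rewrite 0 [d.flip] [] (by clear h; decide +kernel +revert)
    FlexEqu [d.flip] [d.flip] _
      [⟨[d.flip], .cup d, []⟩, ⟨[], .cap d.flip, [d.flip]⟩] :=
      (hasR2_flip d (!s)).rewrite 1 [d.flip] [] (by clear h; decide +kernel +revert)
    FlexEqu [d.flip] [d.flip] _ _ := .iso (by clear h; decide +kernel +revert)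

/-- A curl to the left is an upside down curl to the right. -/
theorem flexEqu_curl_rotate (d : Dir) (s : Bool) :
    FlexEqu [d] [d]
      [⟨[], .cup d.flip, [d]⟩, ⟨[d.flip], .cross d d s, []⟩, ⟨[], .cap d.flip, [d]⟩]
      [⟨[d], .cup d.flip, []⟩, ⟨[d, d.flip], .cup d.flip, [d]⟩, ⟨[d], .cross d.flip d.flip s, [d, d]⟩,
        ⟨[d, d.flip], .cap d.flip, [d]⟩, ⟨[], .cap d, [d]⟩] :=
  calc
    FlexEqu [d] [d] _
      [⟨[d], .cup d.flip, []⟩, ⟨[d, d.flip], .cup d.flip, [d]⟩,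
        ⟨[d], .cup d.flip, [d.flip, d.flip, d, d]⟩,
        ⟨[d, d.flip], .cup d.flip, [d, d.flip, d.flip, d, d]⟩,
        ⟨[d, d.flip, d.flip], .cross d d s, [d.flip, d.flip, d, d]⟩,
        ⟨[d, d.flip, d.flip, d], .cap d, [d.flip, d, d]⟩,
        ⟨[d, d.flip, d.flip], .cap d, [d, d]⟩,
        ⟨[d, d.flip], .cap d.flip, [d]⟩, ⟨[], .cap d, [d]⟩] :=
      .iso (by decide +kernel +revert)
    FlexEqu [d] [d] _ _ :=
      (flexEqu_cross_half_turn d d s).symm.rewrite 2 [d] [d, d] (by decide +kernel +revert)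

theorem HasR1Right.rotate {d : Dir} {s : Bool} (h : HasR1Right d.flip s) : HasR1Left d s :=
  calc
    FlexEqu [d] [d] _ _ := flexEqu_curl_rotate d s
    FlexEqu [d] [d] _ [⟨[d], .cup d.flip, []⟩, ⟨[], .cap d, [d]⟩] :=
      h.rewrite 1 [d] [d] (by clear h; decide +kernel +revert)
    FlexEqu [d] [d] _ _ := .iso (by clear h; decide +kernel +revert)

theorem HasR1Left.rotate {d : Dir} {s : Bool} (h : HasR1Left d s) : HasR1Right d.flip s :=
  calc
    FlexEqu [d.flip] [d.flip] _
      [⟨[], .cup d.flip, [d.flip]⟩, ⟨[d.flip, d], .cup d.flip, [d.flip]⟩,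
        ⟨[d.flip, d, d.flip], .cup d.flip, [d, d.flip]⟩,
        ⟨[d.flip, d], .cross d.flip d.flip s, [d, d, d.flip]⟩,
        ⟨[d.flip, d, d.flip], .cap d.flip, [d, d.flip]⟩, ⟨[d.flip], .cap d, [d, d.flip]⟩,
        ⟨[d.flip], .cap d, []⟩] := .iso (by clear h; decide +kernel +revert)
    FlexEqu [d.flip] [d.flip] _
      [⟨[], .cup d.flip, [d.flip]⟩, ⟨[d.flip], .cup d.flip, [d, d.flip]⟩,
        ⟨[d.flip, d.flip], .cross d d s, [d.flip]⟩, ⟨[d.flip], .cap d.flip, [d, d.flip]⟩,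
        ⟨[d.flip], .cap d, []⟩] :=
      (flexEqu_curl_rotate d s).symm.rewrite 1 [d.flip] [d.flip]
        (by clear h; decide +kernel +revert)
    FlexEqu [d.flip] [d.flip] _ [⟨[], .cup d.flip, [d.flip]⟩, ⟨[d.flip], .cap d, []⟩] :=
      h.rewrite 1 [d.flip] [d.flip] (by clear h; decide +kernel +revert)
    FlexEqu [d.flip] [d.flip] _ _ := .iso (by clear h; decide +kernel +revert)

theorem hasR1Right_up_true : HasR1Right up true :=
  .of_rule (.upright .r1r) (by decide +kernel) (by decide +kernel)

theorem hasR1Left_up_true : HasR1Left up true :=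
  .of_rule (.upright .r1l) (by decide +kernel) (by decide +kernel)

/-- R1r and the half turn of R1l give the two positive right curls, and `HasR1Right.flip` gives the
two negative ones. -/
theorem hasR1Right : ∀ (d : Dir) (s : Bool), HasR1Right d s
  | up, true => hasR1Right_up_true
  | down, false => hasR1Right_up_true.flip
  | down, true => hasR1Left_up_true.rotate
  | up, false => hasR1Left_up_true.rotate.flip

theorem hasR1Left (d : Dir) (s : Bool) : HasR1Left d s := (hasR1Right d.flip s).rotate

/-- The braid-like second Reidemeister move, by pulling a curl of one strand over the other
strand. -/
theorem HasR3.hasR2_up_up {s : Bool} (h : HasR3 up up up s false (!s)) : HasR2 up up s :=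
  calc
    FlexEqu [up, up] [up, up] _
      [⟨[], .cross up up s, []⟩, ⟨[up, up], .cup up, []⟩, ⟨[up], .cross up up false, [down]⟩,
        ⟨[up, up], .cap up, []⟩, ⟨[], .cross up up (!s), []⟩] :=
      (hasR1Right up false).symm.rewrite 1 [up] [] (by clear h; decide +kernel +revert)
    -- The extrema of the new curl move outside the two given crossings, which now form a triangle
    -- with the crossing of the curl.
    FlexEqu [up, up] [up, up] _
      [⟨[up, up], .cup up, []⟩, ⟨[], .cross up up s, [up, down]⟩,
        ⟨[up], .cross up up false, [down]⟩, ⟨[], .cross up up (!s), [up, down]⟩,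
        ⟨[up, up], .cap up, []⟩] := .iso (by clear h; decide +kernel +revert)
    FlexEqu [up, up] [up, up] _
      [⟨[up, up], .cup up, []⟩, ⟨[up], .cross up up (!s), [down]⟩,
        ⟨[], .cross up up false, [up, down]⟩, ⟨[up], .cross up up s, [down]⟩,
        ⟨[up, up], .cap up, []⟩] := h.rewrite 1 [] [down] (by clear h; decide +kernel +revert)
    -- After the triangle move, both crossings are slid to the downward leg of the curl, where
    -- antiparallel R2 removes them.
    FlexEqu [up, up] [up, up] _
      [⟨[up], .cup up, [up]⟩, ⟨[up, up], .cross down up s, []⟩,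
        ⟨[], .cross up up false, [up, down]⟩, ⟨[up], .cross up up s, [down]⟩,
        ⟨[up, up], .cap up, []⟩] :=
      (flexEqu_rotation_cup up up s).symm.rewrite 0 [up] [] (by clear h; decide +kernel +revert)
    FlexEqu [up, up] [up, up] _
      [⟨[up], .cup up, [up]⟩, ⟨[up, up], .cross down up s, []⟩,
        ⟨[], .cross up up false, [up, down]⟩, ⟨[up, up], .cross up down (!s), []⟩,
        ⟨[up], .cap up, [up]⟩] :=
      (flexEqu_rotation_cap up up s).rewrite 3 [up] [] (by clear h; decide +kernel +revert)
    FlexEqu [up, up] [up, up] _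
      [⟨[up], .cup up, [up]⟩, ⟨[], .cross up up false, [down, up]⟩,
        ⟨[up, up], .cross down up s, []⟩, ⟨[up, up], .cross up down (!s), []⟩,
        ⟨[up], .cap up, [up]⟩] := .iso (by clear h; decide +kernel +revert)
    FlexEqu [up, up] [up, up] _
      [⟨[up], .cup up, [up]⟩, ⟨[], .cross up up false, [down, up]⟩, ⟨[up], .cap up, [up]⟩] :=
      (hasR2_flip down s).rewrite 2 [up, up] [] (by clear h; decide +kernel +revert)
    FlexEqu [up, up] [up, up] _ _ :=
      (hasR1Right up false).rewrite 0 [] [up] (by clear h; decide +kernel +revert)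

theorem hasR3_up_true : HasR3 up up up true true true :=
  (Equ.of_rule (.upright .r3b) (by decide +kernel) (by decide +kernel) : FlexEqu _ _ _ _).symm

/-- `HasR3.hasR2_up_up` needs R3 with mixed signs while parallel R2 is still missing. So R3b is
first turned until one strand is antiparallel to the other two; carrying that strand past both uses
antiparallel R2 only, and turning once more in the same sense makes all strands point up again. -/
theorem hasR2 : ∀ (a b : Dir) (s : Bool), HasR2 a b s := by
  have h₁ : HasR2 up up false := by
    have h : HasR3 down up up false false true := hasR3_up_true.rotate_back
    exact HasR3.hasR2_up_up ((h.swap_left (hasR2_flip down false) (hasR2_flip up true)).swap_right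
      (hasR2_flip down false) (hasR2_flip up true)).rotate_back
  have h₂ : HasR2 up up true := by
    have h : HasR3 up up down true false false := hasR3_up_true.rotate
    exact HasR3.hasR2_up_up ((h.swap_right (hasR2_flip up false) (hasR2_flip down true)).swap_left
      (hasR2_flip up false) (hasR2_flip down true)).rotate
  rintro (_ | _) (_ | _) (_ | _)
  exacts [h₁, h₂, hasR2_flip up false, hasR2_flip up true, hasR2_flip down false,
    hasR2_flip down true, h₂.rotate, h₁.rotate]

/-- Two swaps carry `a` past both other strands, and a sixth turn back returns it to the first
place, reversed; the crossing data come back unchanged. -/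
theorem HasR3.flip_left {a b c : Dir} {s₁ s₂ s₃ : Bool} (h : HasR3 a b c s₁ s₂ s₃) :
    HasR3 a.flip b c s₁ s₂ s₃ := by
  simpa using ((h.swap_left (hasR2 _ _ _) (hasR2 _ _ _)).swap_right
    (hasR2 _ _ _) (hasR2 _ _ _)).rotate_back

theorem HasR3.flip_middle {a b c : Dir} {s₁ s₂ s₃ : Bool} (h : HasR3 a b c s₁ s₂ s₃) :
    HasR3 a b.flip c s₁ s₂ s₃ := by
  simpa [Dir.flip_flip] using h.rotate.flip_left.rotate_back

theorem HasR3.flip_right {a b c : Dir} {s₁ s₂ s₃ : Bool} (h : HasR3 a b c s₁ s₂ s₃) :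
    HasR3 a b c.flip s₁ s₂ s₃ := by
  simpa [Dir.flip_flip] using h.rotate_back.flip_left.rotate

theorem hasR3 (a b c : Dir) (s₁ s₂ s₃ : Bool) (h : s₁ = s₃ → s₂ = s₁) :
    HasR3 a b c s₁ s₂ s₃ := by
  have left : ∀ {s₁ s₂ s₃ : Bool}, HasR3 up up up s₁ s₂ s₃ → HasR3 up up up (!s₁) s₃ s₂ :=
    fun h => h.swap_left (hasR2 _ _ _) (hasR2 _ _ _)
  have right : ∀ {s₁ s₂ s₃ : Bool}, HasR3 up up up s₁ s₂ s₃ → HasR3 up up up s₂ s₁ (!s₃) :=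
    fun h => h.swap_right (hasR2 _ _ _) (hasR2 _ _ _)
  have h₀ := hasR3_up_true
  have key : HasR3 up up up s₁ s₂ s₃ := by
    -- The six admissible sign patterns are the six height orders of three strands; `left` and
    -- `right` reach all of them from R3b.
    cases s₁ <;> cases s₂ <;> cases s₃ <;> simp at h
    exacts [right (left (right h₀)), left (right h₀), left h₀, right (left h₀), right h₀, h₀]
  have hc : HasR3 up up c s₁ s₂ s₃ := by cases c; exacts [key, key.flip_right]
  have hb : HasR3 up b c s₁ s₂ s₃ := by cases b; exacts [hc, hc.flip_middle]
  cases a; exacts [hb, hb.flip_left]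

/-! ### Full turns of crossings from the upright moves. -/

/-- Equivalence of diagrams with given boundaries, generated by the isotopies that keep the
crossings upright and the upright moves. -/
abbrev UprightEqu : List Dir → List Dir → List Layer → List Layer → Prop := Equ UprightMove

/-- A diagram with boundaries `[a, b]` and `[c, d]`, rotated by a full turn. -/
def swirl (a b c d : Dir) (w : List Layer) : List Layer :=
  [⟨[], .cup c, [a, b]⟩, ⟨[c], .cup d, [c.flip, a, b]⟩,
    ⟨[c, d], .cup b.flip, [d.flip, c.flip, a, b]⟩,
    ⟨[c, d, b.flip], .cup a.flip, [b, d.flip, c.flip, a, b]⟩] ++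
  w.map (Layer.pad [c, d, b.flip, a.flip] [d.flip, c.flip, a, b]) ++
  [⟨[c, d, b.flip, a.flip, c], .cap d, [c.flip, a, b]⟩, ⟨[c, d, b.flip, a.flip], .cap c, [a, b]⟩,
    ⟨[c, d, b.flip], .cap a.flip, [b]⟩, ⟨[c, d], .cap b.flip, []⟩]

/-- A crossing with both strands pointing up, turned clockwise. -/
def turnRight (s : Bool) : List Layer :=
  [⟨[down, up], .cup up, []⟩, ⟨[down], .cross up up s, [down]⟩, ⟨[], .cap down, [up, down]⟩]

/-- A crossing with both strands pointing up, turned counterclockwise. -/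
def turnLeft (s : Bool) : List Layer :=
  [⟨[], .cup down, [up, down]⟩, ⟨[down], .cross up up s, [down]⟩, ⟨[down, up], .cap up, []⟩]

/-- A crossing with both strands pointing up, turned upside down. -/
def turnOver (s : Bool) : List Layer :=
  [⟨[], .cup down, [down, down]⟩] ++ (turnLeft s).map (Layer.pad [down] [down]) ++
    [⟨[down, down], .cap up, []⟩]

/-- Read this way, the two R2c moves say that `turnRight true` and `turnLeft false` are inverse to
each other. -/
theorem uprightEqu_turnRight_turnLeft :
    UprightEqu [down, up] [down, up] (turnRight true ++ turnLeft false) [] :=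
  .of_rule .r2cNeg (by decide +kernel) (by decide +kernel)

theorem uprightEqu_turnLeft_turnRight :
    UprightEqu [up, down] [up, down] (turnLeft false ++ turnRight true) [] :=
  .of_rule .r2cPos (by decide +kernel) (by decide +kernel)

theorem uprightEqu_swirl_true :
    UprightEqu [up, up] [up, up] [⟨[], .cross up up true, []⟩]
      (swirl up up up up [⟨[], .cross up up true, []⟩]) :=
  .of_rule .sw (by decide +kernel) (by decide +kernel)

/-- Inverses are unique: `turnLeft false` and its swirl are both inverse to `turnRight true`, the
swirl because Sw lets the positive crossing turn along with it. -/
theorem uprightEqu_swirl_turnLeft :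
    UprightEqu [up, down] [down, up] (turnLeft false) (swirl up down down up (turnLeft false)) := by
  have h : UprightEqu [down, up] [down, up]
      (turnRight true ++ swirl up down down up (turnLeft false)) [] :=
    calc
      UprightEqu [down, up] [down, up] _
        ([⟨[down, up], .cup up, []⟩] ++
          (swirl up up up up [⟨[], .cross up up true, []⟩]).map (Layer.pad [down] [down]) ++
          [⟨[], .cap down, [up, down]⟩] ++ swirl up down down up (turnLeft false)) :=
        uprightEqu_swirl_true.rewrite 1 [down] [down] (by decide +kernel)
      UprightEqu [down, up] [down, up] _
        (swirl down up down up (turnRight true ++ turnLeft false)) := .iso (by decide +kernel)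
      UprightEqu [down, up] [down, up] _ (swirl down up down up []) :=
        uprightEqu_turnRight_turnLeft.rewrite 4 [down, up, down, up] [down, up, down, up]
          (by decide +kernel)
      UprightEqu [down, up] [down, up] _ [] := .iso (by decide +kernel)
  -- By `h` the swirl cancels `turnRight true` when placed on top of it; putting `turnLeft false`
  -- below compares the two inverses.
  have h₁ := (h.append_left (A := turnLeft false) (x := [up, down]) (by decide +kernel)).symm
  have h₂ := uprightEqu_turnLeft_turnRight.append_right (y := [down, up])
    (B := swirl up down down up (turnLeft false)) (by decide +kernel)
  rw [List.append_assoc] at h₂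
  simpa using h₁.trans h₂

theorem uprightEqu_swirl : ∀ s : Bool,
    UprightEqu [up, up] [up, up] [⟨[], .cross up up s, []⟩]
      (swirl up up up up [⟨[], .cross up up s, []⟩])
  | true => uprightEqu_swirl_true
  | false =>
    calc
      UprightEqu [up, up] [up, up] _
        ([⟨[up, up], .cup down, []⟩] ++ (turnLeft false).map (Layer.pad [up] [up]) ++
          [⟨[], .cap up, [up, up]⟩]) := .iso (by decide +kernel)
      UprightEqu [up, up] [up, up] _
        ([⟨[up, up], .cup down, []⟩] ++
          (swirl up down down up (turnLeft false)).map (Layer.pad [up] [up]) ++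
          [⟨[], .cap up, [up, up]⟩]) :=
        uprightEqu_swirl_turnLeft.rewrite 1 [up] [up] (by decide +kernel)
      UprightEqu [up, up] [up, up] _ _ := .iso (by decide +kernel)

/-! ### Turning all crossings upright respects the moves. -/

/-- Turn a crossing until both strands point up. -/
def Elem.uprightForm : Elem → List Layer
  | .cross .up .down s => turnLeft (!s)
  | .cross .down .up s => turnRight (!s)
  | .cross .down .down s => turnOver s
  | e => [⟨[], e, []⟩]

/-- Turn the crossing of a layer until both strands point up. -/
def Layer.uprightForm (L : Layer) : List Layer := L.elem.uprightForm.map (pad L.left L.right)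

/-- Turn every crossing until both strands point up. -/
def uprightForm (w : List Layer) : List Layer := w.flatMap Layer.uprightForm

theorem Elem.isTangle_uprightForm (e : Elem) : IsTangle e.src e.uprightForm e.tgt := by
  rcases e with d | d | ⟨a, b, s⟩ | _ <;> decide +kernel +revert

theorem Layer.isTangle_uprightForm (L : Layer) : IsTangle L.src L.uprightForm L.tgt :=
  L.elem.isTangle_uprightForm.pad L.left L.right

theorem IsTangle.uprightForm : ∀ {w : List Layer} {x y : List Dir},
    IsTangle x w y → IsTangle x (uprightForm w) y
  | [], _, _, h => h
  | L :: _, _, _, h => by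
    obtain ⟨rfl, h⟩ := h
    exact L.isTangle_uprightForm.append h.uprightForm

theorem uprightForm_append (u v : List Layer) :
    uprightForm (u ++ v) = uprightForm u ++ uprightForm v := List.flatMap_append

theorem uprightForm_map_pad (l r : List Dir) (w : List Layer) :
    uprightForm (w.map (Layer.pad l r)) = (uprightForm w).map (Layer.pad l r) := by
  have h : ∀ L : Layer, (L.pad l r).uprightForm = L.uprightForm.map (Layer.pad l r) := fun L => by
    simp [Layer.uprightForm, Layer.pad]
  simp [uprightForm, List.flatMap_map, List.map_flatMap, h]

theorem Elem.IsUpright.uprightForm {e : Elem} (h : e.IsUpright) : e.uprightForm = [⟨[], e, []⟩] := by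
  rcases e with d | d | ⟨a, b, s⟩ | _ <;> try rfl
  cases a <;> cases b <;> first | rfl | exact h.elim

theorem uprightForm_eq_self {w : List Layer} (h : ∀ L ∈ w, L.elem.IsUpright) :
    uprightForm w = w := by
  induction w with
  | nil => rfl
  | cons L w ih =>
    have hL : L.uprightForm = [L] := by
      simp [Layer.uprightForm, (h L (by simp)).uprightForm, Layer.pad]
    change L.uprightForm ++ uprightForm w = _
    rw [hL, ih fun M hM => h M (by simp [hM])]
    rfl

/-- A replacement holds inside a diagram, after turning the crossings, if it does so locally. -/
theorem LocalStep.uprightEqu {R : List Layer → List Layer → Prop}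
    (hR : ∀ u v, R u v → ∃ p q, u ≠ [] ∧ IsTangle p u q ∧
      UprightEqu p q (uprightForm u) (uprightForm v))
    {w w' : List Layer} {x y : List Dir} (h : LocalStep R w w') (hw : IsTangle x w y) :
    UprightEqu x y (uprightForm w) (uprightForm w') := by
  obtain ⟨A, B, l, r, u, v, huv, rfl, rfl⟩ := h
  obtain ⟨p, q, hne, hu, he⟩ := hR u v huv
  obtain ⟨z, hAu, hB⟩ := hw.split
  obtain ⟨t, hA, hu'⟩ := hAu.split
  have unique : ∀ {w : List Layer} {a b c : List Dir}, IsTangle a w b → IsTangle a w c → b = c := by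
    intro w
    induction w with
    | nil => exact fun h h' => (Eq.symm h).trans h'
    | cons L w ih => exact fun h h' => ih h.2 h'.2
  -- The first layer of `u` fixes its bottom boundary; an empty `u` would fit any boundary.
  have ht : t = l ++ p ++ r := by
    cases u with
    | nil => exact absurd rfl hne
    | cons L u => rw [hu'.1, Layer.src_pad, hu.1]
  subst ht
  have hz := unique hu' (hu.pad l r)
  subst hz
  simp only [uprightForm_append, uprightForm_map_pad]
  exact he.context hA.uprightForm hB.uprightForm

/-- A turned crossing occupies several layers, so an exchange of two pieces becomes an exchange of
two stacks. -/
theorem Isotopy.uprightEqu {u v : List Layer} (h : Isotopy u v) :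
    ∃ p q, u ≠ [] ∧ IsTangle p u q ∧ UprightEqu p q (uprightForm u) (uprightForm v) := by
  cases h with
  | exchange e f m =>
    refine ⟨e.src ++ m ++ f.src, e.tgt ++ m ++ f.tgt, by simp,
      by simp [IsTangle, Layer.src, Layer.tgt], ?_⟩
    simpa [uprightForm, Layer.uprightForm] using
      Equ.exchange m f.isTangle_uprightForm e.isTangle_uprightForm
  | zigzagRight d =>
    exact ⟨[d], [d], by simp, by decide +kernel +revert, .iso (by decide +kernel +revert)⟩
  | zigzagLeft d =>
    exact ⟨[d], [d], by simp, by decide +kernel +revert, .iso (by decide +kernel +revert)⟩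

theorem UprightMove.isTangle {u v : List Layer} (h : UprightMove u v) :
    ∃ p q, u ≠ [] ∧ IsTangle p u q ∧ IsTangle p v q := by
  cases h
  exacts [⟨[up], [up], by decide +kernel⟩, ⟨[up], [up], by decide +kernel⟩,
    ⟨[up, down], [up, down], by decide +kernel⟩, ⟨[down, up], [down, up], by decide +kernel⟩,
    ⟨[up, up, up], [up, up, up], by decide +kernel⟩, ⟨[up], [up], by decide +kernel⟩,
    ⟨[up, up], [up, up], by decide +kernel⟩]

theorem UprightMove.isUpright {u v : List Layer} (h : UprightMove u v) :
    (∀ L ∈ u, L.elem.IsUpright) ∧ ∀ L ∈ v, L.elem.IsUpright := by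
  cases h <;> simp [Elem.IsUpright]

theorem UprightMove.uprightEqu {u v : List Layer} (h : UprightMove u v) :
    ∃ p q, u ≠ [] ∧ IsTangle p u q ∧ UprightEqu p q (uprightForm u) (uprightForm v) := by
  obtain ⟨p, q, hne, hu, hv⟩ := h.isTangle
  refine ⟨p, q, hne, hu, ?_⟩
  rw [uprightForm_eq_self h.isUpright.1, uprightForm_eq_self h.isUpright.2]
  exact .of_rule h hu hv

theorem uprightEqu_rotation_cap (a b : Dir) (s : Bool) :
    UprightEqu [a, b, a.flip] [b]
      (uprightForm [⟨[], .cross a b s, [a.flip]⟩, ⟨[b], .cap a, []⟩])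
      (uprightForm [⟨[a], .cross b a.flip (!s), []⟩, ⟨[], .cap a, [b]⟩]) := by
  cases a <;> cases b
  · exact .iso (by decide +kernel +revert)
  · exact .iso (by decide +kernel +revert)
  · exact .iso (by decide +kernel +revert)
  -- Both strands of the left crossing point down. `turnOver` consists of two left turns, while the
  -- right crossing gets a right turn, so the two sides differ by a full turn.
  · refine .trans (.iso (by decide +kernel +revert)) (.symm (.trans
      (v := [⟨[down, down, up], .cup up, []⟩] ++
        (swirl up up up up [⟨[], .cross up up s, []⟩]).map (Layer.pad [down, down] [down]) ++
        [⟨[down], .cap down, [up, down]⟩, ⟨[], .cap down, [down]⟩])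
      ((uprightEqu_swirl s).rewrite 1 [down, down] [down] (by decide +kernel +revert))
      (.iso (w' := uprightForm [⟨[], .cross down down s, [up]⟩, ⟨[down], .cap down, []⟩])
        (by decide +kernel +revert))))

theorem uprightEqu_rotation_cup (a b : Dir) (s : Bool) :
    UprightEqu [b] [a, b, a.flip]
      (uprightForm [⟨[], .cup a, [b]⟩, ⟨[a], .cross a.flip b s, []⟩])
      (uprightForm [⟨[b], .cup a, []⟩, ⟨[], .cross b a (!s), [a.flip]⟩]) := by
  cases a <;> cases b
  · exact .iso (by decide +kernel +revert)
  -- Again `turnOver` meets `turnRight`, and a full turn makes up the difference.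
  · refine .symm (.trans
      (v := [⟨[down], .cup up, []⟩, ⟨[down, up], .cup up, [down]⟩] ++
        (swirl up up up up [⟨[], .cross up up s, []⟩]).map (Layer.pad [down] [down, down]) ++
        [⟨[], .cap down, [up, down, down]⟩])
      ((uprightEqu_swirl s).rewrite 2 [down] [down, down] (by decide +kernel +revert))
      (.iso (by decide +kernel +revert)))
  · exact .iso (by decide +kernel +revert)
  · exact .iso (by decide +kernel +revert)

theorem Rotation.uprightEqu {u v : List Layer} (h : Rotation u v) :
    ∃ p q, u ≠ [] ∧ IsTangle p u q ∧ UprightEqu p q (uprightForm u) (uprightForm v) := by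
  cases h with
  | cap a b s =>
    exact ⟨_, _, by simp, by decide +kernel +revert, uprightEqu_rotation_cap a b s⟩
  | cup a b s =>
    exact ⟨_, _, by simp, by decide +kernel +revert, uprightEqu_rotation_cup a b s⟩

theorem Equ.uprightForm {x y : List Dir} {u v : List Layer} (h : FlexEqu x y u v) :
    UprightEqu x y (uprightForm u) (uprightForm v) := by
  induction h with
  | rel u v h =>
    refine h.1.uprightEqu ?_ h.2.1
    rintro u v (h | h | h)
    exacts [h.uprightEqu, h.uprightEqu, h.uprightEqu]
  | refl u => exact .refl _
  | symm u v _ ih => exact ih.symm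
  | trans u v w _ _ ih₁ ih₂ => exact ih₁.trans ih₂

theorem Reidemeister.uprightEqu {u v : List Layer} (h : Reidemeister u v) :
    ∃ p q, u ≠ [] ∧ IsTangle p u q ∧ UprightEqu p q (uprightForm u) (uprightForm v) := by
  cases h with
  | r1Right d s =>
    exact ⟨_, _, by simp, by decide +kernel +revert, (hasR1Right d s).uprightForm⟩
  | r1Left d s =>
    exact ⟨_, _, by simp, by decide +kernel +revert, (hasR1Left d s).uprightForm⟩
  | r2 a b s =>
    exact ⟨_, _, by simp, by decide +kernel +revert, (hasR2 a b s).uprightForm⟩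
  | r3 a b c s₁ s₂ s₃ h =>
    exact ⟨_, _, by simp, by clear h; decide +kernel +revert,
      (hasR3 a b c s₁ s₂ s₃ h).uprightForm⟩

/-! ### From stacks back to upright diagrams. -/

theorem uprightEqu_of_orientedSteps {D D' : OrientedDiagram}
    (h : Relation.EqvGen OrientedStep D D') :
    UprightEqu [up] [up] (uprightForm D.layers) (uprightForm D'.layers) := by
  induction h with
  | rel D D' h =>
    refine LocalStep.uprightEqu ?_ h D.isTangle
    rintro u v (h | h | h)
    exacts [h.uprightEqu, h.uprightEqu, h.uprightEqu]
  | refl D => exact .refl _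
  | symm D D' _ ih => exact ih.symm
  | trans D D' D'' _ _ ih₁ ih₂ => exact ih₁.trans ih₂

theorem uprightEqu_eraseNull : ∀ {w : List Layer} {x y : List Dir}, IsTangle x w y →
    UprightEqu x y w (eraseNull w)
  | [], _, _, _ => .refl _
  | ⟨l, e, r⟩ :: w, x, y, h => by
    by_cases he : e = .null
    · subst he
      obtain ⟨rfl, h⟩ := h
      refine Equ.trans (v := w) ?_ (uprightEqu_eraseNull h)
      refine .rel _ _ ⟨⟨[], w, l, r, _, _, .inr .nv, ?_, ?_⟩, ⟨rfl, h⟩, h⟩ <;> simp [Layer.pad]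
    · have h' : eraseNull (⟨l, e, r⟩ :: w) = ⟨l, e, r⟩ :: eraseNull w := by
        cases e <;> first | rfl | exact absurd rfl he
      rw [h']
      exact (uprightEqu_eraseNull h.2).append_left (A := [⟨l, e, r⟩]) ⟨h.1, rfl⟩

theorem LocalStep.forall_isUpright_iff {w w' : List Layer}
    (h : LocalStep (fun u v => Isotopy u v ∨ UprightMove u v) w w') :
    (∀ L ∈ w, L.elem.IsUpright) ↔ ∀ L ∈ w', L.elem.IsUpright := by
  obtain ⟨A, B, l, r, u, v, huv, rfl, rfl⟩ := h
  have h : (∀ L ∈ u, L.elem.IsUpright) ↔ ∀ L ∈ v, L.elem.IsUpright := by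
    rcases huv with h | h
    · cases h <;> simp [Elem.IsUpright, and_comm]
    · exact iff_of_true h.isUpright.1 h.isUpright.2
  simp only [List.forall_mem_append, List.forall_mem_map, Layer.pad, h]

/-- A chain in `UprightEqu` runs through bare stacks, whereas `UprightEquivalent` needs upright
diagrams at every stage. The equivalence in the first component carries this property along the
chain, in particular to the middle stack of a composition. -/
theorem Equ.uprightEquivalent {u v : List Layer} (h : UprightEqu [up] [up] u v) :
    ((IsTangle [up] u [up] ∧ ∀ L ∈ u, L.elem.IsUpright) ↔
        IsTangle [up] v [up] ∧ ∀ L ∈ v, L.elem.IsUpright) ∧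
      ∀ hu hu' hv hv', UprightEquivalent ⟨u, hu, hu'⟩ ⟨v, hv, hv'⟩ := by
  induction h with
  | rel u v h =>
    exact ⟨by rw [h.1.forall_isUpright_iff]; simp only [h.2.1, h.2.2],
      fun _ _ _ _ => .rel _ _ h.1⟩
  | refl u => exact ⟨Iff.rfl, fun _ _ _ _ => .refl _⟩
  | symm u v _ ih => exact ⟨ih.1.symm, fun hu hu' hv hv' => .symm _ _ (ih.2 hv hv' hu hu')⟩
  | trans u v w _ _ ih₁ ih₂ =>
    refine ⟨ih₁.1.trans ih₂.1, fun hu hu' hw hw' => ?_⟩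
    have hv := ih₁.1.1 ⟨hu, hu'⟩
    exact .trans _ _ _ (ih₁.2 hu hu' hv.1 hv.2) (ih₂.2 hv.1 hv.2 hw hw')

theorem UprightDiagram.uprightForm_toOriented (D : UprightDiagram) :
    uprightForm D.toOriented.layers = eraseNull D.layers :=
  uprightForm_eq_self fun L hL => D.upright L (List.mem_of_mem_filter hL)

end UprightKnots

theorem proposition3 (D D' : UprightKnots.UprightDiagram) (hD : D.IsKnot) (hD' : D'.IsKnot)
    (h : UprightKnots.RepresentSameKnot D D') : UprightKnots.UprightEquivalent D D' := by
  have h₁ := UprightKnots.uprightEqu_of_orientedSteps h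
  rw [D.uprightForm_toOriented, D'.uprightForm_toOriented] at h₁
  have h₂ := ((UprightKnots.uprightEqu_eraseNull D.isTangle).trans h₁).trans
    (UprightKnots.uprightEqu_eraseNull D'.isTangle).symm
  exact h₂.uprightEquivalent.2 D.isTangle D.upright D'.isTangle D'.upright
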